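/- Let $\mathbb F$ be a finite field and $1\le k\le d$. A linear MSR code with parameters $\{n=d+1,k,d,\alpha,\beta\}$, where $\alpha=(d-k+1)\beta$, encodes a message $x\in\mathbb F^{B}$, $B=k\alpha$, linearly: node $i\in\{1,\dots,d+1\}$ stores a vector $W_i\in\mathbb F^{\alpha}$ that is a linear function of $x$, and to repair node $j$ each other node $i$ sends a vector $S_i^j\in\mathbb F^{\beta}$ that is a linear function of $W_i$; the contents of any $k$ nodes determine $x$, and $(S_i^j)_{i\ne j}$ determines $W_j$. For a set $F$ of nodes and a node $g\notin F$ let $H(S_g^F)$ be the Shannon entropy in base $|\mathbb F|$ of $S_g^F=(S_g^j)_{j\in F}$ when $x$ is uniformly distributed on $\mathbb F^B$. An $(l_1,l_2)$-eavesdropper picks disjoint sets $E,F$ of $l_1$ and $l_2$ nodes and observes $W_E=(W_i)_{i\in E}$ and $S^F=(S_i^j)_{j\in F,\,i\neq j}$. A file is stored by letting $x$ be a (randomized) encoding of a random variable $D$ with finitely many values, with symbols in an arbitrary finite extension field $K$ of $\mathbb F$ to which the same code is applied, so that $D$ can be recovered from any $k$ nodes; the storage is secure against $(E,F)$ if $I(D;W_E,S^F)=0$,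 and the size of the file is $H(D)$ in base $|K|$. The secrecy capacity $B^{(s)}$ is the largest size of a securely stored file. **Theorem.** For a linear MSR code with parameters $\{n=d+1,k,d,\alpha,\beta\}$ and $l_1+l_2\le k-1$, $$B^{(s)}=(k-l_1-l_2)\bigl(\alpha-\pi(\beta,l_2)\bigr),$$ in each of the following two senses: (a) for any fixed pair $(E,F)$ of disjoint sets of $l_1$ and $l_2$ nodes, with security required against $(E,F)$, and $\pi(\beta,l_2)=H(S_g^F)$ for every node $g\notin F$; (b) with security required against every such pair $(E,F)$ simultaneously, and $\pi(\beta,l_2)=\max\{H(S_g^F): |F|=l_2,\ g\notin F\}$. In both cases, for all integers $1\le t\le d-k+1$ and $e\ge 1$, $$\pi(\beta,l_2)\ \begin{cases}=l_2\beta, & \text{if } l_2\le t \text{ and } \beta<\frac{d-k+1}{t-1},\\[2pt] \ge t\beta+\beta(d-k-t+1)\Bigl[1-\bigl(\tfrac{d-k}{d-k+1}\bigr)^{e}\Bigr], & \text{if } l_2=t+e \text{ and } \frac{d-k+1}{t}\le\beta<\frac{d-k+1}{t-1},\end{cases}$$ where the condition $\beta<\frac{d-k+1}{t-1}$ is void for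 $t=1$. -/

import Mathlib

open Matrix

noncomputable section

namespace SecureMSR

universe u

/-! ### Shannon entropy of finitely valued random variables -/

/-- Shannon entropy `H(X) = - ∑ₓ p(x) log_b p(x)` in base `b` of a random variable `X` with
finitely many values, on a discrete probability space `(Ω, p)`. -/
def entropy {Ω γ : Type*} [Fintype γ] (b : ℕ) (p : PMF Ω) (X : Ω → γ) : ℝ :=
  -∑ c, (p.map X c).toReal * Real.logb b (p.map X c).toReal

/-- Mutual information `I(X;Y) = H(X) + H(Y) - H(X,Y)`. -/
def mutualInfo {Ω γ δ : Type*} [Fintype γ] [Fintype δ] (b : ℕ) (p : PMF Ω)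
    (X : Ω → γ) (Y : Ω → δ) : ℝ :=
  entropy b p X + entropy b p Y - entropy b p (fun ω => (X ω, Y ω))

/-! ### Linear regenerating codes with `n = d + 1` nodes -/

/-- A linear regenerating code over `𝔽` with `n = d + 1` nodes and exact repair of all nodes.
The message is a vector `x` of `B` symbols. Node `i` stores the `α` symbols `store i *ᵥ x`; to
repair node `j`, node `i ≠ j` sends the `β` symbols `repair i j *ᵥ (store i *ᵥ x)`
(the value of `repair i i` plays no role). -/
structure LinearRegeneratingCode (𝔽 : Type u) [Field 𝔽] (k d α β B : ℕ) where
  store : Fin (d + 1) → Matrix (Fin α) (Fin B) 𝔽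
  repair : Fin (d + 1) → Fin (d + 1) → Matrix (Fin β) (Fin α) 𝔽
  /-- The contents of any `k` nodes determine the message. -/
  reconstruction : ∀ A : Finset (Fin (d + 1)), A.card = k → ∀ x y : Fin B → 𝔽,
    (∀ i ∈ A, store i *ᵥ x = store i *ᵥ y) → x = y
  /-- The data sent by the `d` other nodes determine the content of node `j`. -/
  regeneration : ∀ (j : Fin (d + 1)) (x y : Fin B → 𝔽),
    (∀ i, i ≠ j → repair i j *ᵥ (store i *ᵥ x) = repair i j *ᵥ (store i *ᵥ y)) →
      store j *ᵥ x = store j *ᵥ y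

/-- The parameters of the minimum storage regenerating (MSR) point:
`α = B / k` and `β = B / (k (d - k + 1))`, with `k ≤ d`. -/
def IsMSR (k d α β B : ℕ) : Prop :=
  k ≤ d ∧ B = k * α ∧ α = (d - k + 1) * β

namespace LinearRegeneratingCode

variable {𝔽 : Type u} [Field 𝔽] {k d α β B : ℕ}

/-- The content `W_i` of node `i`, when the message symbols lie in an extension `K` of `𝔽`
(the encoding coefficients are still those of the code over `𝔽`). -/
def content (C : LinearRegeneratingCode 𝔽 k d α β B) (K : Type u) [Field K] [Algebra 𝔽 K]
    (i : Fin (d + 1)) (x : Fin B → K) : Fin α → K :=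
  (C.store i).map (algebraMap 𝔽 K) *ᵥ x

/-- The repair data `S_i^j` sent by node `i` for the repair of node `j`. -/
def repairData (C : LinearRegeneratingCode 𝔽 k d α β B) (K : Type u) [Field K] [Algebra 𝔽 K]
    (i j : Fin (d + 1)) (x : Fin B → K) : Fin β → K :=
  (C.repair i j).map (algebraMap 𝔽 K) *ᵥ C.content K i x

/-- The entropy `H(S_g^F)`, in base `|𝔽|`, of the data sent by node `g` for the repair of all the
nodes of `F` (used for `g ∉ F`), when the message is uniformly distributed on `𝔽^B`. -/
def repairEntropy [Fintype 𝔽] (C : LinearRegeneratingCode 𝔽 k d α β B)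
    (g : Fin (d + 1)) (F : Finset (Fin (d + 1))) : ℝ :=
  entropy (Fintype.card 𝔽) (PMF.uniformOfFintype (Fin B → 𝔽))
    (fun x (j : F) => C.repairData 𝔽 g j x)

/-- What an eavesdropper on `(E, F)` sees: the contents `W_E` of the nodes of `E` and the repair
data `S^F = (S_i^j)`, `j ∈ F`, `i ≠ j`, received by the nodes of `F`. -/
def observation (C : LinearRegeneratingCode 𝔽 k d α β B) (K : Type u) [Field K] [Algebra 𝔽 K]
    (E F : Finset (Fin (d + 1))) (x : Fin B → K) :
    (E → Fin α → K) × ((j : F) → {i : Fin (d + 1) // i ≠ j} → Fin β → K) :=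
  (fun i => C.content K i x, fun j i => C.repairData K i j x)

/-- A way to store a random file `D` securely: `p` is the joint law of `D` and of the vector `x`
of `B` symbols that is encoded by the code (so `x` may depend on `D` and on added randomness).
The file can be retrieved from any `k` nodes, and for every pair `(E, F)` that the eavesdropper
may have chosen, `I(D; W_E, S^F) = 0`. -/
def IsSecureStorage (C : LinearRegeneratingCode 𝔽 k d α β B)
    (𝓔 : Set (Finset (Fin (d + 1)) × Finset (Fin (d + 1))))
    (K : Type u) [Field K] [Fintype K] [Algebra 𝔽 K] {N : ℕ}
    (p : PMF (Fin N × (Fin B → K))) : Prop :=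
  (∀ A : Finset (Fin (d + 1)), A.card = k → ∀ a ∈ p.support, ∀ b ∈ p.support,
    (∀ i ∈ A, C.content K i a.2 = C.content K i b.2) → a.1 = b.1) ∧
  ∀ EF ∈ 𝓔, mutualInfo (Fintype.card K) p Prod.fst
    (fun a => C.observation K EF.1 EF.2 a.2) = 0

/-- The sizes `H(D)` of the files that can be stored securely with the code against the
eavesdroppers in `𝓔`. The symbols are taken from an arbitrary finite extension field `K` of `𝔽`
and the file size is measured in symbols, that is, in base `|K|`. -/
def secureFileSizes (C : LinearRegeneratingCode 𝔽 k d α β B)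
    (𝓔 : Set (Finset (Fin (d + 1)) × Finset (Fin (d + 1)))) : Set ℝ :=
  {r | ∃ (K : Type u) (_ : Field K) (_ : Fintype K) (_ : Algebra 𝔽 K) (N : ℕ)
      (p : PMF (Fin N × (Fin B → K))),
    C.IsSecureStorage 𝓔 K p ∧ r = entropy (Fintype.card K) p Prod.fst}

/-- `Bs` is the secrecy capacity: the largest size of a file that can be stored securely. -/
def IsSecrecyCapacity (C : LinearRegeneratingCode 𝔽 k d α β B)
    (𝓔 : Set (Finset (Fin (d + 1)) × Finset (Fin (d + 1)))) (Bs : ℝ) : Prop :=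
  IsGreatest (C.secureFileSizes 𝓔) Bs

end LinearRegeneratingCode

/-- The possible choices of an `(l₁, l₂)`-eavesdropper among `n` nodes: disjoint sets `E`, `F` of
`l₁` and `l₂` nodes. -/
def eavesdroppers (n l₁ l₂ : ℕ) : Set (Finset (Fin n) × Finset (Fin n)) :=
  {EF | EF.1.card = l₁ ∧ EF.2.card = l₂ ∧ Disjoint EF.1 EF.2}

/-- The explicit description of `π = π(β, l₂)`. The condition `β < (d - k + 1) / (t - 1)`, void
for `t = 1`, is written `(t - 1) β < d - k + 1`. -/
def PiDescription (k d β l₂ : ℕ) (π : ℝ) : Prop :=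
  ∀ t : ℕ, 1 ≤ t → (t : ℝ) ≤ (d : ℝ) - k + 1 → ((t : ℝ) - 1) * β < (d : ℝ) - k + 1 →
    (l₂ ≤ t → π = l₂ * β) ∧
    (∀ e : ℕ, 1 ≤ e → l₂ = t + e → ((d : ℝ) - k + 1) / t ≤ β →
      t * β + β * ((d : ℝ) - k - t + 1) * (1 - (((d : ℝ) - k) / ((d : ℝ) - k + 1)) ^ e) ≤ π)

end SecureMSR

end

noncomputable section

namespace SecureMSR

open Module Finset

universe u

/-! ### Families of subspaces with the exact repair property -/

section Subspaces

variable {F V ι : Type*} [Field F] [AddCommGroup V] [Module F V] [FiniteDimensional F V]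

/-! The argument is dual linear algebra plus two entropy estimates. Let `R i` be the span of the
functionals stored at node `i`, `W i j` the span of those it sends to repair `j`, and `r = d - k +
1`. At the MSR point every dimension count is tight. Any `k` of the `R i` form a direct sum filling
the space. For `k - 1` nodes `A` and `j ∉ A`, the spaces `W p j` of the `r` remaining nodes are
independent modulo the `R i`, `i ∈ A`. All repair data for `j` together span `R j` plus the data of
any `k - 1` helpers.

So the observation of `(E, F)` is the direct sum of the `R i`, `i ∈ E ∪ F`, and of the spans of
`S_g^F` for `g` in any set `G` completing `E ∪ F` to `k` nodes (`finrank_observation`). Exchanging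
one node of `G` shows that `S_g^F` has the same rank `π` for every `g ∉ F`. The unseen messages thus
form a space of dimension `(k - l₁ - l₂)(α - π)`.

The capacity is the least such dimension. Independence bounds `H(D)` by the log-size of a fibre of
the observation (`entropy_le_finrank_ker`). Conversely, over a large field some subspace `Z` is in
general position to all the kernels at once, and `D = x mod Z` is secure (`mem_secureFileSizes`).

For the bounds on `π`, adding `j` to `F` raises the rank by `β - x`, where `r x` is at most the old
rank (`finrank_inf_repair_le`). Integrality forces `x = 0` early on; afterwards the deficit from `r
β` shrinks at least by the factor `1 - 1/r` per node. -/

theorem finrank_sup_le_sum (S : Finset ι) (X : ι → Submodule F V) :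
    finrank F (S.sup X : Submodule F V) ≤ ∑ i ∈ S, finrank F (X i) := by
  classical
  induction S using Finset.induction_on with
  | empty => simp
  | insert a S ha ih =>
    rw [sup_insert, sum_insert ha]
    exact (Submodule.finrank_add_le_finrank_add_finrank _ _).trans (by gcongr)

theorem finrank_sup_of_disjoint {X Y : Submodule F V} (h : Disjoint X Y) :
    finrank F (X ⊔ Y : Submodule F V) = finrank F X + finrank F Y := by
  rw [← Submodule.finrank_sup_add_finrank_inf_eq, h.eq_bot, finrank_bot, add_zero]

theorem disjoint_of_finrank_le {X Y : Submodule F V}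
    (h : finrank F X + finrank F Y ≤ finrank F (X ⊔ Y : Submodule F V)) : Disjoint X Y := by
  have := Submodule.finrank_sup_add_finrank_inf_eq X Y
  rw [disjoint_iff, ← Submodule.finrank_eq_zero (R := F)]
  omega

theorem finrank_sup_of_supIndep {S : Finset ι} {X : ι → Submodule F V} (h : S.SupIndep X) :
    finrank F (S.sup X : Submodule F V) = ∑ i ∈ S, finrank F (X i) := by
  classical
  induction S using Finset.induction_on with
  | empty => simp
  | insert a S ha ih =>
    rw [sup_insert, sum_insert ha, ← ih (h.subset (subset_insert _ _))]
    exact finrank_sup_of_disjoint (h (subset_insert _ _) (mem_insert_self _ _) ha)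

theorem supIndep_of_finrank_le {S : Finset ι} {X : ι → Submodule F V}
    (h : ∑ i ∈ S, finrank F (X i) ≤ finrank F (S.sup X : Submodule F V)) : S.SupIndep X := by
  classical
  rw [supIndep_iff_disjoint_erase]
  intro i hi
  apply disjoint_of_finrank_le
  rw [← sup_insert, insert_erase hi]
  refine le_trans ?_ h
  rw [← add_sum_erase _ _ hi]
  gcongr
  exact finrank_sup_le_sum _ _

/-- Subspaces `R i`, spanned by the functionals stored at the nodes, and `W i j ≤ R i`, spanned by
the functionals sent by node `i` for the repair of node `j`, at the minimum storage point. -/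
structure IsRepairFamily [Fintype ι] [DecidableEq ι] (k r a b : ℕ) (R : ι → Submodule F V)
    (W : ι → ι → Submodule F V) : Prop where
  card_eq : Fintype.card ι = k + r
  r_pos : 0 < r
  a_eq : a = r * b
  finrank_eq : finrank F V = k * a
  finrank_store : ∀ i, finrank F (R i) ≤ a
  finrank_repair : ∀ i j, finrank F (W i j) ≤ b
  repair_le : ∀ i j, W i j ≤ R i
  span : ∀ A : Finset ι, A.card = k → A.sup R = ⊤
  regenerate : ∀ j, R j ≤ (univ.erase j).sup fun i => W i j

namespace IsRepairFamily

variable [Fintype ι] [DecidableEq ι] {k r a b : ℕ} {R : ι → Submodule F V}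
  {W : ι → ι → Submodule F V}

/-- These `k` spaces of dimension at most `a` span a space of dimension `k * a`, so no dimension may
be lost. -/
theorem supIndep_of_card_eq (h : IsRepairFamily k r a b R W) {S : Finset ι} (hS : S.card = k) :
    S.SupIndep R := by
  apply supIndep_of_finrank_le
  rw [h.span S hS, finrank_top, h.finrank_eq, ← hS, ← smul_eq_mul]
  exact sum_le_card_nsmul _ _ _ fun i _ => h.finrank_store i

omit [FiniteDimensional F V] in
theorem exists_superset (h : IsRepairFamily k r a b R W) {S : Finset ι} (hS : S.card ≤ k) :
    ∃ A, S ⊆ A ∧ A.card = k :=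
  exists_superset_card_eq hS (by rw [h.card_eq]; omega)

theorem supIndep (h : IsRepairFamily k r a b R W) {S : Finset ι} (hS : S.card ≤ k) :
    S.SupIndep R := by
  obtain ⟨A, hSA, hA⟩ := h.exists_superset hS
  exact (h.supIndep_of_card_eq hA).subset hSA

theorem finrank_store_eq (h : IsRepairFamily k r a b R W) (hk : 0 < k) (i : ι) :
    finrank F (R i) = a := by
  obtain ⟨A, hSA, hA⟩ := h.exists_superset (S := {i}) (by rw [card_singleton]; exact hk)
  have hi : i ∈ A := hSA (mem_singleton_self i)
  have h1 := finrank_sup_of_supIndep (h.supIndep_of_card_eq hA)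
  rw [h.span A hA, finrank_top, h.finrank_eq, ← hA, ← smul_eq_mul, ← sum_const] at h1
  exact ((sum_eq_sum_iff_of_le fun i _ => h.finrank_store i).1 h1.symm) i hi

/-- The data sent by nodes `G` for the repair of `j` is a basis modulo `k - 1` other nodes. -/
theorem supIndep_repair (h : IsRepairFamily k r a b R W) {A : Finset ι} {j : ι}
    (hj : j ∉ A) (hA : A.card + 1 = k) :
    (∀ p ∉ insert j A, finrank F (W p j) = b) ∧
      ((insert j A)ᶜ).SupIndep (fun p => W p j) ∧
      Disjoint (A.sup R) ((insert j A)ᶜ.sup fun p => W p j) := by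
  have hk : 0 < k := by omega
  set G := (insert j A)ᶜ with hG
  have hGc : G.card = r := by
    have := card_compl_add_card (insert j A)
    rw [h.card_eq, card_insert_of_notMem hj, ← hG] at this
    omega
  -- Helpers in `A` add nothing modulo `A.sup R`, so the `r` helpers in `G` must supply the missing
  -- `a = r * b` dimensions with at most `b` each. Equality throughout gives all three claims.
  have htop : A.sup R ⊔ G.sup (fun p => W p j) = ⊤ := by
    rw [eq_top_iff, ← h.span (insert j A) (by rw [card_insert_of_notMem hj, hA]), sup_insert]
    refine sup_le ((h.regenerate j).trans (Finset.sup_le fun i hi => ?_)) le_sup_left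
    by_cases hiA : i ∈ A
    · exact (h.repair_le i j).trans ((le_sup hiA).trans le_sup_left)
    · refine le_trans ?_ le_sup_right
      exact le_sup (f := fun p => W p j) (by simp_all)
  have hRA : finrank F (A.sup R : Submodule F V) = A.card * a := by
    rw [finrank_sup_of_supIndep (h.supIndep (by omega)),
      sum_congr rfl fun i _ => h.finrank_store_eq hk i, sum_const, smul_eq_mul]
  have hsum : ∑ p ∈ G, finrank F (W p j) ≤ ∑ p ∈ G, b := sum_le_sum fun p _ => h.finrank_repair p j
  have hGb : ∑ p ∈ G, b = a := by rw [sum_const, hGc, smul_eq_mul, h.a_eq]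
  have hle := finrank_sup_le_sum G fun p => W p j
  have hadd := Submodule.finrank_add_le_finrank_add_finrank (A.sup R) (G.sup fun p => W p j)
  have htot : finrank F (A.sup R ⊔ G.sup (fun p => W p j) : Submodule F V) = A.card * a + a := by
    rw [htop, finrank_top, h.finrank_eq, ← hA]; ring
  refine ⟨fun p hp => ?_, supIndep_of_finrank_le (by omega), disjoint_of_finrank_le (by omega)⟩
  exact ((sum_eq_sum_iff_of_le fun p _ => h.finrank_repair p j).1 (hsum.antisymm (by omega))) p (by simpa [hG] using hp)

theorem finrank_repair_eq (h : IsRepairFamily k r a b R W) (hk : 0 < k) {i j : ι} (hij : i ≠ j) :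
    finrank F (W i j) = b := by
  have hc : k - 1 ≤ (({i, j} : Finset ι)ᶜ).card := by
    have := card_compl_add_card ({i, j} : Finset ι)
    have := h.r_pos
    rw [h.card_eq, card_pair hij] at *
    omega
  obtain ⟨A, hA, hAc⟩ := exists_subset_card_eq hc
  have hi : i ∉ A := fun hi => by simpa using hA hi
  have hj : j ∉ A := fun hj => by simpa using hA hj
  exact (h.supIndep_repair hj (by omega)).1 i (by simp [hi, hij])

/-- The data sent by all nodes for the repair of `j` is equivalent to the content of `j` together
with the data sent by any `k - 1` nodes. -/
theorem sup_repair_eq (h : IsRepairFamily k r a b R W) {A : Finset ι} {j : ι}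
    (hj : j ∉ A) (hA : A.card + 1 = k) :
    (univ.erase j).sup (fun i => W i j) = R j ⊔ A.sup fun i => W i j := by
  have hk : 0 < k := by omega
  symm
  have hle : R j ⊔ A.sup (fun i => W i j) ≤ (univ.erase j).sup (fun i => W i j) := by
    refine sup_le (h.regenerate j) (sup_mono fun i hi => ?_)
    exact mem_erase.2 ⟨by rintro rfl; exact hj hi, mem_univ _⟩
  -- The `k + r - 1` helpers span at most `(k + r - 1) * b` dimensions, which is exactly the `r * b
  -- + (k - 1) * b` of the direct sum.
  apply Submodule.eq_of_le_of_finrank_le hle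
  have hd : Disjoint (R j) (A.sup fun i => W i j) :=
    (h.supIndep (S := insert j A) (by rw [card_insert_of_notMem hj, hA])
      (subset_insert _ _) (mem_insert_self _ _) hj).mono_right
      (Finset.sup_mono_fun fun i _ => h.repair_le i j)
  have hA' : ∑ i ∈ A, finrank F (W i j) = ∑ i ∈ A, b := sum_congr rfl fun i hi =>
    h.finrank_repair_eq hk (by rintro rfl; exact hj hi)
  have hAW : finrank F (A.sup fun i => W i j : Submodule F V) = A.card * b := by
    rw [finrank_sup_of_supIndep
      ((h.supIndep (by omega)).mono fun i _ => h.repair_le i j), hA', sum_const, smul_eq_mul]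
  rw [finrank_sup_of_disjoint hd, h.finrank_store_eq hk, hAW, h.a_eq, ← add_mul]
  refine (finrank_sup_le_sum _ _).trans ?_
  refine (sum_le_card_nsmul _ _ b fun i _ => h.finrank_repair i j).trans ?_
  rw [smul_eq_mul, card_erase_of_mem (mem_univ _), card_univ, h.card_eq]
  gcongr
  omega

/-- By `sup_repair_eq`, the repair data for `j ∈ T` reduce to `R j` and the data of the other `k -
1` nodes of `S ∪ T ∪ G`. Nodes of `S ∪ T` are already known in full, so only the data from `G` are
new, and they lie in independent `R g`. -/
theorem finrank_observation (h : IsRepairFamily k r a b R W) {S T G : Finset ι}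
    (hST : Disjoint S T) (hG : Disjoint G (S ∪ T)) (hc : S.card + T.card + G.card = k)
    (hG0 : 0 < G.card) :
    finrank F (S.sup R ⊔ T.sup (fun j => (univ.erase j).sup fun i => W i j) : Submodule F V) =
      (S.card + T.card) * a + ∑ g ∈ G, finrank F (T.sup (W g) : Submodule F V) := by
  have hk : 0 < k := by omega
  set X : ι → Submodule F V := fun i => if i ∈ G then T.sup (W i) else R i with hX
  have hA : ((S ∪ T) ∪ G).card = k := by
    rw [card_union_of_disjoint hG.symm, card_union_of_disjoint hST, hc]
  have hXR : ∀ i, X i ≤ R i := fun i => by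
    simp only [hX]
    split_ifs
    · exact Finset.sup_le fun j _ => h.repair_le i j
    · exact le_rfl
  have hn : ∀ i ∈ S ∪ T, i ∉ G := fun i hi hiG => disjoint_left.1 hG hiG hi
  have heq : S.sup R ⊔ T.sup (fun j => (univ.erase j).sup fun i => W i j) =
      ((S ∪ T) ∪ G).sup X := by
    have hXe : ∀ i ∈ S ∪ T, R i ≤ ((S ∪ T) ∪ G).sup X := fun i hi => by
      refine le_trans ?_ (le_sup (f := X) (mem_union_left G hi))
      simp only [hX, if_neg (hn i hi), le_refl]
    apply le_antisymm
    · refine sup_le (Finset.sup_le fun i hi => hXe i (mem_union_left _ hi))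
        (Finset.sup_le fun j hj => ?_)
      have hjA : j ∈ (S ∪ T) ∪ G := mem_union_left _ (mem_union_right _ hj)
      rw [h.sup_repair_eq (notMem_erase j ((S ∪ T) ∪ G))
        (by rw [card_erase_of_mem hjA, hA]; omega)]
      refine sup_le (hXe j (mem_union_right _ hj)) (Finset.sup_le fun i hi => ?_)
      refine le_trans ?_ (le_sup (f := X) (mem_of_mem_erase hi))
      simp only [hX]
      split_ifs
      · exact le_sup (f := W i) hj
      · exact h.repair_le i j
    · refine Finset.sup_le fun i hi => ?_
      simp only [hX]
      split_ifs with hiG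
      · refine le_trans (Finset.sup_le fun j hj => ?_) le_sup_right
        refine le_trans ?_ (le_sup (f := fun j => (univ.erase j).sup fun i => W i j) hj)
        refine le_sup (f := fun i => W i j) (mem_erase.2 ⟨?_, mem_univ _⟩)
        rintro rfl
        exact hn i (mem_union_right _ hj) hiG
      · rcases mem_union.1 hi with hi | hi
        · rcases mem_union.1 hi with hi | hi
          · exact (le_sup (f := R) hi).trans le_sup_left
          · exact ((h.regenerate i).trans
              (le_sup (f := fun j => (univ.erase j).sup fun i => W i j) hi)).trans le_sup_right
        · exact absurd hi hiG
  rw [heq, finrank_sup_of_supIndep ((h.supIndep hA.le).mono fun i _ => hXR i),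
    sum_union hG.symm, ← card_union_of_disjoint hST, ← smul_eq_mul, ← sum_const]
  congr 1
  · refine sum_congr rfl fun i hi => ?_
    rw [show X i = R i from if_neg (hn i hi), h.finrank_store_eq hk]
  · refine sum_congr rfl fun i hi => ?_
    rw [show X i = T.sup (W i) from if_pos hi]

/-- Take `S = ∅` in `finrank_observation` and complete `T` by `insert g G` or by `insert g' G`: the
observed space is the same, so the two differing summands agree. -/
theorem finrank_sup_repair_eq (h : IsRepairFamily k r a b R W) {T : Finset ι} (hT : T.card < k)
    {g g' : ι} (hg : g ∉ T) (hg' : g' ∉ T) :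
    finrank F (T.sup (W g) : Submodule F V) = finrank F (T.sup (W g') : Submodule F V) := by
  rcases eq_or_ne g g' with rfl | hne
  · rfl
  have hc : k - T.card - 1 ≤ ((T ∪ {g, g'})ᶜ).card := by
    have := card_compl_add_card (T ∪ {g, g'})
    have := card_union_le T {g, g'}
    have := h.r_pos
    rw [h.card_eq, card_pair hne] at *
    omega
  obtain ⟨G, hG, hGc⟩ := exists_subset_card_eq hc
  have hmem : ∀ i ∈ G, i ∉ T ∧ i ≠ g ∧ i ≠ g' := fun i hi => by
    have := hG hi
    simp only [mem_compl, mem_union, mem_insert, mem_singleton, not_or] at this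
    exact this
  have key : ∀ x ∉ T, x ∉ G →
      finrank F ((∅ : Finset ι).sup R ⊔ T.sup (fun j => (univ.erase j).sup fun i => W i j)
        : Submodule F V) = ((∅ : Finset ι).card + T.card) * a +
        (finrank F (T.sup (W x) : Submodule F V) +
          ∑ g ∈ G, finrank F (T.sup (W g) : Submodule F V)) := fun x hx hxG => by
    rw [← sum_insert (f := fun g => finrank F (T.sup (W g) : Submodule F V)) hxG]
    apply h.finrank_observation (disjoint_empty_left _)
    · rw [empty_union, disjoint_insert_left]
      exact ⟨hx, disjoint_left.2 fun i hi => (hmem i hi).1⟩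
    · rw [card_insert_of_notMem hxG, card_empty]; omega
    · rw [card_insert_of_notMem hxG]; omega
  have h1 := key g hg fun hi => (hmem g hi).2.1 rfl
  have h2 := key g' hg' fun hi => (hmem g' hi).2.2 rfl
  omega

/-- Adding a node `j` to `T`: the overlap at `g` of the data for `j` with the data for `T`. -/
theorem finrank_inf_repair_le (h : IsRepairFamily k r a b R W) {T : Finset ι} {j g : ι}
    (hT : T.card + 1 < k) (hj : j ∉ T) (hg : g ∉ insert j T) :
    r * finrank F (W g j ⊓ T.sup (W g) : Submodule F V) ≤
      finrank F (T.sup (W g) : Submodule F V) := by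
  have hk : 0 < k := by omega
  have hgT : g ∉ T := fun hi => hg (mem_insert_of_mem hi)
  have hgj : g ≠ j := fun hi => hg (hi ▸ mem_insert_self _ _)
  -- The ranks of the data for `T` and for `insert j T` do not depend on the sender, hence neither
  -- does the overlap.
  have hx : ∀ p ∉ insert j T, finrank F (W p j ⊓ T.sup (W p) : Submodule F V) =
      finrank F (W g j ⊓ T.sup (W g) : Submodule F V) := fun p hp => by
    have hpT : p ∉ T := fun hi => hp (mem_insert_of_mem hi)
    have hpj : p ≠ j := fun hi => hp (hi ▸ mem_insert_self _ _)
    have e1 := Submodule.finrank_sup_add_finrank_inf_eq (W p j) (T.sup (W p))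
    have e2 := Submodule.finrank_sup_add_finrank_inf_eq (W g j) (T.sup (W g))
    have e3 := h.finrank_sup_repair_eq (T := insert j T)
      (by rw [card_insert_of_notMem hj]; exact hT) hp hg
    have e4 := h.finrank_sup_repair_eq (T := T) (by omega) hpT hgT
    rw [sup_insert, sup_insert] at e3
    rw [h.finrank_repair_eq hk hpj] at e1
    rw [h.finrank_repair_eq hk hgj] at e2
    omega
  have hcc : k - 1 ≤ (({j} : Finset ι)ᶜ).card := by
    have := card_compl_add_card ({j} : Finset ι)
    have := h.r_pos
    rw [h.card_eq, card_singleton] at *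
    omega
  obtain ⟨A, hTA, hAj, hA⟩ := exists_subsuperset_card_eq (s := T) (t := ({j} : Finset ι)ᶜ)
    (n := k - 1) (fun i hi => by simpa using fun e : i = j => hj (e ▸ hi)) (by omega) hcc
  have hjA : j ∉ A := fun hi => by simpa using hAj hi
  obtain ⟨-, hind, hdis⟩ := h.supIndep_repair hjA (by omega)
  set G := (insert j A)ᶜ with hG
  set Y : ι → Submodule F V := fun p => W p j ⊓ T.sup (W p) with hY
  have hGc : G.card = r := by
    have := card_compl_add_card (insert j A)
    rw [h.card_eq, card_insert_of_notMem hjA, ← hG] at this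
    omega
  have hYd : Disjoint (A.sup R) (G.sup Y) :=
    hdis.mono_right (Finset.sup_mono_fun fun i _ => inf_le_left)
  have hYr : finrank F (G.sup Y : Submodule F V) =
      r * finrank F (W g j ⊓ T.sup (W g) : Submodule F V) := by
    rw [finrank_sup_of_supIndep (hind.mono fun i _ => inf_le_left), ← hGc, ← smul_eq_mul,
      ← sum_const]
    refine sum_congr rfl fun p hp => hx p fun hi => ?_
    rw [hG, mem_compl] at hp
    exact hp (insert_subset_insert _ hTA hi)
  -- The `r` overlaps `Y p` are independent modulo `A.sup R`; this inclusion makes them fit, modulo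
  -- `A.sup R`, into the data sent by the single node `j` for `T`. For `l ∈ T`, the `k - 1`
  -- reference helpers are `j` and `A.erase l`.
  have hle : A.sup R ⊔ G.sup Y ≤ A.sup R ⊔ T.sup (W j) := by
    refine sup_le le_sup_left (Finset.sup_le fun p hp => inf_le_right.trans
      (Finset.sup_le fun l hl => ?_))
    rw [hG, mem_compl, mem_insert, not_or] at hp
    have hlj : l ≠ j := fun e => hj (e ▸ hl)
    have hlA := hTA hl
    have hpl : p ≠ l := by rintro rfl; exact hp.2 hlA
    refine (le_sup (f := fun i => W i l) (mem_erase.2 ⟨hpl, mem_univ p⟩)).trans ?_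
    rw [h.sup_repair_eq (A := insert j (A.erase l)) (by simp [hlj])
      (by rw [card_insert_of_notMem (by simp [hjA]), card_erase_of_mem hlA]; omega)]
    refine sup_le ((le_sup hlA).trans le_sup_left) ?_
    rw [sup_insert]
    refine sup_le ((le_sup (f := W j) hl).trans le_sup_right)
      ((Finset.sup_le fun i hi => ?_).trans le_sup_left)
    exact (h.repair_le i l).trans (le_sup (mem_of_mem_erase hi))
  have h1 := Submodule.finrank_mono hle
  have h2 := Submodule.finrank_add_le_finrank_add_finrank (A.sup R) (T.sup (W j))
  rw [finrank_sup_of_disjoint hYd, hYr] at h1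
  have h3 := h.finrank_sup_repair_eq (T := T) (by omega) hj hgT
  omega

/-! ### Growth of the rank of the repair data -/

theorem finrank_sup_insert (h : IsRepairFamily k r a b R W) {T : Finset ι} {j g : ι}
    (hT : T.card + 1 < k) (hj : j ∉ T) (hg : g ∉ insert j T) :
    ∃ x, finrank F ((insert j T).sup (W g) : Submodule F V) + x =
        b + finrank F (T.sup (W g) : Submodule F V) ∧
      r * x ≤ finrank F (T.sup (W g) : Submodule F V) := by
  refine ⟨_, ?_, h.finrank_inf_repair_le hT hj hg⟩
  rw [sup_insert, Submodule.finrank_sup_add_finrank_inf_eq, h.finrank_repair_eq (by omega)]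
  exact fun hi => hg (hi ▸ mem_insert_self _ _)

/-- As long as the rank is below `r`, the integer overlap `x` with `r * x` at most that rank must
vanish, so each new node contributes a full `b`. -/
theorem finrank_sup_eq_mul (h : IsRepairFamily k r a b R W) {t : ℕ}
    (ht : (t - 1) * b < r) {T : Finset ι} (hTt : T.card ≤ t) (hT : T.card < k) {g : ι}
    (hg : g ∉ T) : finrank F (T.sup (W g) : Submodule F V) = T.card * b := by
  induction T using Finset.induction_on with
  | empty => simp
  | insert j T hj ih =>
    rw [card_insert_of_notMem hj] at hT hTt ⊢
    obtain ⟨x, hx, hrx⟩ := h.finrank_sup_insert hT hj hg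
    rw [ih (by omega) (by omega) fun hi => hg (mem_insert_of_mem hi)] at hx hrx
    have hb : T.card * b ≤ (t - 1) * b := Nat.mul_le_mul_right _ (by omega)
    have hx0 : x = 0 := by
      by_contra hne
      have := Nat.le_mul_of_pos_right r (Nat.pos_of_ne_zero hne)
      omega
    rw [add_mul, one_mul]
    omega

/-- The recursion `D' ≥ b + (1 - 1/r) D` has fixed point `r * b`; it is iterated `e` times from `D =
t * b`. -/
theorem finrank_sup_ge (h : IsRepairFamily k r a b R W) {t : ℕ}
    (ht : (t - 1) * b < r) (e : ℕ) {T : Finset ι} (hTt : T.card = t + e) (hT : T.card < k) {g : ι}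
    (hg : g ∉ T) :
    (r * b : ℝ) - (r - t) * b * (1 - 1 / r) ^ e ≤ finrank F (T.sup (W g) : Submodule F V) := by
  have hr : (0 : ℝ) < r := by exact_mod_cast h.r_pos
  induction e generalizing T with
  | zero =>
    rw [h.finrank_sup_eq_mul ht (by omega) hT hg, hTt]
    push_cast
    linarith
  | succ e ih =>
    obtain ⟨j, T, hj, rfl, -⟩ := (card_eq_succ (n := t + e)).1 hTt
    rw [card_insert_of_notMem hj] at hT hTt
    obtain ⟨x, hx, hrx⟩ := h.finrank_sup_insert hT hj hg
    have hi := ih (T := T) (by omega) (by omega) fun hi => hg (mem_insert_of_mem hi)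
    set D := finrank F (T.sup (W g) : Submodule F V)
    have hx' : (finrank F ((insert j T).sup (W g) : Submodule F V) : ℝ) = b + D - x := by
      rw [eq_sub_iff_add_eq]; exact_mod_cast hx
    have hxD : (x : ℝ) ≤ D / r := by
      rw [le_div_iff₀ hr, mul_comm]; exact_mod_cast hrx
    have hq : (0 : ℝ) ≤ 1 - 1 / r := by
      rw [sub_nonneg, div_le_one hr]; exact_mod_cast h.r_pos
    have := mul_le_mul_of_nonneg_left hi hq
    rw [hx']
    have e1 : (1 - 1 / (r : ℝ)) * (r * b) = r * b - b := by field_simp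
    have e2 : (1 - 1 / (r : ℝ)) * D = D - D / r := by ring
    rw [mul_sub, e1, e2] at this
    rw [pow_succ]
    linarith

theorem piDescription {d l : ℕ} (h : IsRepairFamily k r a b R W) (hd : k + r = d + 1)
    {T : Finset ι} (hTl : T.card = l) (hT : l < k) {g : ι} (hg : g ∉ T) :
    PiDescription k d b l (finrank F (T.sup (W g) : Submodule F V)) := by
  have hr : (r : ℝ) = d - k + 1 := by
    have : (k : ℝ) + r = d + 1 := by exact_mod_cast hd
    linarith
  have hr0 : (r : ℝ) ≠ 0 := by exact_mod_cast h.r_pos.ne'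
  intro t ht _ htb
  have htr : (t - 1) * b < r := by
    rw [← hr] at htb
    have : ((t - 1 : ℕ) : ℝ) * b < r := by rwa [Nat.cast_sub ht, Nat.cast_one]
    exact_mod_cast this
  subst hTl
  refine ⟨fun hl => ?_, fun e _ he _ => ?_⟩
  · rw [h.finrank_sup_eq_mul htr hl hT hg]; push_cast; ring
  · refine le_trans (le_of_eq ?_) (h.finrank_sup_ge htr e he hT hg)
    have e1 : ((d : ℝ) - k) / (d - k + 1) = 1 - 1 / r := by
      rw [← hr]; field_simp; linarith
    have e2 : (d : ℝ) - k - t + 1 = r - t := by linarith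
    rw [e1, e2]
    ring

end IsRepairFamily

end Subspaces

/-! ### Entropy on finite probability spaces -/

section Entropy

variable {Ω γ δ : Type*} [Fintype Ω] [Fintype γ] [Fintype δ]

omit [Fintype γ] in
theorem map_apply_toReal [DecidableEq γ] (p : PMF Ω) (X : Ω → γ) (c : γ) :
    (p.map X c).toReal = ∑ ω with X ω = c, (p ω).toReal := by
  rw [PMF.map_apply, tsum_fintype, ENNReal.toReal_sum, sum_filter]
  · refine sum_congr rfl fun ω _ => ?_
    by_cases h : X ω = c
    · simp [h]
    · simp [h, Ne.symm h]
  · intro ω _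
    split_ifs
    · exact p.apply_ne_top ω
    · exact ENNReal.zero_ne_top

theorem sum_map_mul (p : PMF Ω) (X : Ω → γ) (g : γ → ℝ) :
    ∑ c, (p.map X c).toReal * g c = ∑ ω, (p ω).toReal * g (X ω) := by
  classical
  simp_rw [map_apply_toReal, sum_mul]
  rw [← sum_fiberwise univ X]
  refine sum_congr rfl fun c _ => sum_congr rfl fun ω hω => ?_
  rw [(mem_filter.1 hω).2]

theorem entropy_eq_sum (b : ℕ) (p : PMF Ω) (X : Ω → γ) :
    entropy b p X = -∑ ω, (p ω).toReal * Real.logb b (p.map X (X ω)).toReal := by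
  rw [entropy, sum_map_mul p X fun c => Real.logb b (p.map X c).toReal]

theorem sum_toReal_eq_one (p : PMF Ω) : ∑ ω, (p ω).toReal = 1 := by
  rw [← ENNReal.toReal_sum fun ω _ => p.apply_ne_top ω, ← tsum_fintype (L := .unconditional _),
    p.tsum_coe, ENNReal.toReal_one]

omit [Fintype γ] in
theorem map_apply_self_pos (p : PMF Ω) (X : Ω → γ) {ω : Ω} (hω : ω ∈ p.support) :
    0 < (p.map X (X ω)).toReal := by
  classical
  rw [map_apply_toReal]
  exact sum_pos' (fun _ _ => ENNReal.toReal_nonneg)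
    ⟨ω, by simp, ENNReal.toReal_pos ((p.mem_support_iff ω).1 hω) (p.apply_ne_top ω)⟩

/-- `H(X, Y) ≤ H(Y) + log m` if `X` takes at most `m` values for each value of `Y`. -/
theorem entropy_pair_le {b m : ℕ} (hb : 1 < b) (hm : 0 < m) (p : PMF Ω) (X : Ω → γ) (Y : Ω → δ)
    (h : ∀ y, {x | (x, y) ∈ (p.map fun ω => (X ω, Y ω)).support}.ncard ≤ m) :
    entropy b p (fun ω => (X ω, Y ω)) ≤ entropy b p Y + Real.logb b m := by
  classical
  have hlb : 0 < Real.log b := Real.log_pos (by exact_mod_cast hb)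
  have hm' : (0 : ℝ) < m := by exact_mod_cast hm
  set Z : Ω → γ × δ := fun ω => (X ω, Y ω) with hZ
  set P : γ × δ → ℝ := fun z => (p.map Z z).toReal with hP
  set Q : δ → ℝ := fun y => (p.map Y y).toReal with hQ
  -- Gibbs' inequality: `log u ≤ u - 1` will be averaged at `u = Q / (P * m)`, whose mean is at most
  -- 1 by this bound.
  have hsum : ∑ ω, (p ω).toReal * (Q (Y ω) / P (Z ω)) ≤ m := by
    rw [← sum_map_mul p Z fun z => Q z.2 / P z, Fintype.sum_prod_type_right]
    calc ∑ y, ∑ x, (p.map Z (x, y)).toReal * (Q y / P (x, y))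
        ≤ ∑ y, Q y * m := by
          refine sum_le_sum fun y _ => ?_
          calc ∑ x, (p.map Z (x, y)).toReal * (Q y / P (x, y))
              = ∑ x with (x, y) ∈ (p.map Z).support, Q y := by
                rw [sum_filter]
                refine sum_congr rfl fun x _ => ?_
                split_ifs with hx
                · have : P (x, y) ≠ 0 := by
                    rw [hP]
                    exact (ENNReal.toReal_pos ((PMF.mem_support_iff _ _).1 hx)
                      (PMF.apply_ne_top _ _)).ne'
                  change P (x, y) * _ = _
                  field_simp
                · rw [PMF.mem_support_iff, not_not] at hx
                  rw [hx, ENNReal.toReal_zero, zero_mul]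
            _ ≤ Q y * m := by
                rw [sum_const, nsmul_eq_mul, mul_comm]
                have := h y
                rw [Set.ncard_eq_toFinset_card'] at this
                refine mul_le_mul_of_nonneg_left ?_ ENNReal.toReal_nonneg
                refine le_trans ?_ (Nat.cast_le.2 this)
                rw [Nat.cast_le]
                exact card_le_card fun x hx => by simpa using hx
      _ = m := by rw [← sum_mul, hQ, sum_toReal_eq_one, one_mul]
  have hpt : ∀ ω, (p ω).toReal * (Real.log (Q (Y ω)) - Real.log (P (Z ω))) ≤
      (p ω).toReal * (Q (Y ω) / P (Z ω)) / m - (p ω).toReal + (p ω).toReal * Real.log m := by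
    intro ω
    by_cases hω : ω ∈ p.support
    · have h1 : 0 < P (Z ω) := map_apply_self_pos p Z hω
      have h2 : 0 < Q (Y ω) := map_apply_self_pos p Y hω
      have := Real.log_le_sub_one_of_pos (x := Q (Y ω) / P (Z ω) / m) (by positivity)
      rw [Real.log_div (by positivity) (by positivity), Real.log_div h2.ne' h1.ne'] at this
      have := mul_le_mul_of_nonneg_left this (ENNReal.toReal_nonneg (a := p ω))
      have e : (p ω).toReal * (Q (Y ω) / P (Z ω) / m - 1) =
        (p ω).toReal * (Q (Y ω) / P (Z ω)) / m - (p ω).toReal := by ring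
      rw [e] at this
      linarith
    · rw [PMF.mem_support_iff, not_not] at hω
      simp [hω]
  have htot := sum_le_sum fun ω (_ : ω ∈ univ) => hpt ω
  rw [sum_add_distrib, sum_sub_distrib, ← sum_div, ← sum_mul, sum_toReal_eq_one, one_mul] at htot
  have hdiv : (∑ ω, (p ω).toReal * (Q (Y ω) / P (Z ω))) / m ≤ 1 := by
    rwa [div_le_one hm']
  have hfin : ∑ ω, (p ω).toReal * (Real.log (Q (Y ω)) - Real.log (P (Z ω))) ≤ Real.log m := by
    linarith
  rw [entropy_eq_sum, entropy_eq_sum, ← sub_nonneg]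
  have e : -∑ ω, (p ω).toReal * Real.logb b (p.map Y (Y ω)).toReal + Real.logb b m -
      -∑ ω, (p ω).toReal * Real.logb b (p.map Z (Z ω)).toReal =
      (Real.log m - ∑ ω, (p ω).toReal * (Real.log (Q (Y ω)) - Real.log (P (Z ω)))) /
        Real.log b := by
    simp_rw [mul_sub, sum_sub_distrib, Real.logb, ← mul_div_assoc, ← sum_div]
    ring
  rw [e]
  exact div_nonneg (by linarith) hlb.le

omit [Fintype Ω] in
theorem entropy_map {Ω' : Type*} (b : ℕ) (p : PMF Ω') (f : Ω' → Ω) (X : Ω → γ) :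
    entropy b (p.map f) X = entropy b p (X ∘ f) := by
  simp_rw [entropy, PMF.map_comp]

variable {K M N : Type*} [Field K] [Fintype K] [AddCommGroup M] [Module K M] [Fintype M]
  [AddCommGroup N] [Module K N]

omit [Fintype γ] in
theorem card_fiber (f : M →ₗ[K] N) {X : M → γ} [DecidableEq γ]
    (hX : ∀ x y, X x = X y ↔ f x = f y) (x : M) :
    #{y | X y = X x} = Fintype.card K ^ finrank K (LinearMap.ker f) := by
  classical
  rw [← Module.card_eq_pow_finrank (K := K) (V := LinearMap.ker f), ← Fintype.card_subtype]
  refine Fintype.card_congr ⟨fun y => ⟨y.1 - x, ?_⟩, fun z => ⟨z.1 + x, ?_⟩, fun y => ?_,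
    fun z => ?_⟩
  · rw [LinearMap.mem_ker, map_sub, (hX _ _).1 y.2, sub_self]
  · rw [hX, map_add, LinearMap.mem_ker.1 z.2, zero_add]
  · simp
  · simp

/-- The entropy of a linear function of a uniformly distributed vector is its rank. -/
theorem entropy_uniform [Nonempty M] (f : M →ₗ[K] N) {X : M → γ}
    (hX : ∀ x y, X x = X y ↔ f x = f y) :
    entropy (Fintype.card K) (PMF.uniformOfFintype M) X =
      finrank K M - finrank K (LinearMap.ker f) := by
  classical
  have hq : (1 : ℝ) < Fintype.card K := by exact_mod_cast Fintype.one_lt_card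
  have hval : ∀ x, ((PMF.uniformOfFintype M).map X (X x)).toReal =
      (Fintype.card K : ℝ) ^ (finrank K (LinearMap.ker f)) /
        (Fintype.card K : ℝ) ^ (finrank K M) := fun x => by
    rw [map_apply_toReal]
    simp_rw [PMF.uniformOfFintype_apply, ENNReal.toReal_inv, ENNReal.toReal_natCast]
    rw [sum_const, card_fiber f hX, Module.card_eq_pow_finrank (K := K) (V := M), nsmul_eq_mul]
    push_cast
    ring
  rw [entropy_eq_sum]
  simp_rw [hval]
  rw [← sum_mul, sum_toReal_eq_one, one_mul, Real.logb_div (by positivity) (by positivity),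
    Real.logb_pow, Real.logb_pow, Real.logb_self_eq_one hq]
  ring

/-- If `D` is a function of `x` and is independent of a linear function of `x`, then `H(D)` is at
most the dimension of the kernel. -/
theorem entropy_le_finrank_ker {δ : Type*} [Fintype δ] (p : PMF (δ × M)) (f : M →ₗ[K] N)
    {X : M → γ} (hX : ∀ x y, X x = X y ↔ f x = f y)
    (hdet : ∀ u ∈ p.support, ∀ v ∈ p.support, u.2 = v.2 → u.1 = v.1)
    (hI : mutualInfo (Fintype.card K) p Prod.fst (fun u => X u.2) = 0) :
    entropy (Fintype.card K) p Prod.fst ≤ finrank K (LinearMap.ker f) := by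
  classical
  have hq : 1 < Fintype.card K := Fintype.one_lt_card
  have hq' : (1 : ℝ) < Fintype.card K := by exact_mod_cast hq
  have key := entropy_pair_le hq (m := Fintype.card K ^ finrank K (LinearMap.ker f))
    (by positivity) p Prod.fst (fun u => X u.2) fun y => ?_
  · rw [Nat.cast_pow, Real.logb_pow, Real.logb_self_eq_one hq', mul_one] at key
    rw [mutualInfo] at hI
    linarith
  · have hex : ∀ x ∈ {x | (x, y) ∈ (p.map fun u => (u.1, X u.2)).support},
        ∃ z, (x, z) ∈ p.support ∧ X z = y := by
      intro x hx
      rw [Set.mem_ofPred_eq, PMF.support_map] at hx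
      obtain ⟨u, hu, he⟩ := hx
      obtain ⟨rfl, rfl⟩ := Prod.mk.inj he
      exact ⟨u.2, hu, rfl⟩
    rcases Set.eq_empty_or_nonempty {x | (x, y) ∈ (p.map fun u => (u.1, X u.2)).support}
      with h0 | ⟨x0, hx0⟩
    · rw [h0, Set.ncard_empty]
      exact Nat.zero_le _
    · obtain ⟨z0, -, hz0⟩ := hex x0 hx0
      rw [← card_fiber f hX z0, ← Set.ncard_coe_finset]
      choose! g hg using hex
      -- Each file value compatible with `y` is sent to a message carrying it. The message
      -- determines the file, so this injects into one fibre, a coset of the kernel.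
      refine Set.ncard_le_ncard_of_injOn g (fun x hx => ?_) (fun x hx x' hx' he => ?_)
      · simp [(hg x hx).2, hz0]
      · exact hdet _ (hg x hx).1 _ (hg x' hx').1 he

end Entropy

/-! ### Complements of finitely many subspaces, extensions of finite fields, change of field -/

section Subspaces

/-- `Z` grows one vector at a time: the `Z ⊔ N i` are fewer than `|K|` proper subspaces, each with
at most `|K| ^ (dim V - 1)` elements, so they cannot cover `V`. -/
theorem exists_disjoint_of_card_lt {K V : Type*} [Field K] [Fintype K] [AddCommGroup V]
    [Module K V] [FiniteDimensional K V] {ι : Type*} (S : Finset ι) (N : ι → Submodule K V)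
    (hS : S.card < Fintype.card K) (c : ℕ) (hc : ∀ i ∈ S, finrank K (N i) + c ≤ finrank K V)
    (hcV : c ≤ finrank K V) :
    ∃ Z : Submodule K V, finrank K Z = c ∧ ∀ i ∈ S, Disjoint Z (N i) := by
  classical
  induction c with
  | zero => exact ⟨⊥, finrank_bot K V, fun i _ => disjoint_bot_left⟩
  | succ c ih =>
    obtain ⟨Z, hZ, hd⟩ := ih (fun i hi => by have := hc i hi; omega) (by omega)
    have : Fintype V := have := Module.finite_of_finite K (M := V); Fintype.ofFinite V
    obtain ⟨v, hvZ, hv⟩ : ∃ v, v ∉ Z ∧ ∀ i ∈ S, v ∉ Z ⊔ N i := by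
      by_contra! hcon
      rcases S.eq_empty_or_nonempty with rfl | ⟨i0, hi0⟩
      · have htop : Z = ⊤ := eq_top_iff.2 fun v _ => by
          by_contra hvZ
          obtain ⟨i, hi, -⟩ := hcon v hvZ
          simp at hi
        rw [htop, finrank_top] at hZ
        omega
      have hcov : (univ : Finset V) ⊆ S.biUnion fun i => univ.filter (· ∈ Z ⊔ N i) := fun v _ => by
        rw [mem_biUnion]
        by_cases hvZ : v ∈ Z
        · exact ⟨i0, hi0, by simpa using Submodule.mem_sup_left hvZ⟩
        · obtain ⟨i, hi, hvi⟩ := hcon v hvZ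
          exact ⟨i, hi, by simpa using hvi⟩
      have hle := (card_le_card hcov).trans (card_biUnion_le_card_mul S _
        (Fintype.card K ^ (finrank K V - 1)) fun i hi => by
          rw [← Fintype.card_subtype, Module.card_eq_pow_finrank (K := K) (V := ↥(Z ⊔ N i))]
          refine Nat.pow_le_pow_right Fintype.card_pos ?_
          have := Submodule.finrank_add_le_finrank_add_finrank Z (N i)
          have := hc i hi
          omega)
      rw [card_univ, Module.card_eq_pow_finrank (K := K) (V := V)] at hle
      have e : Fintype.card K ^ finrank K V =
          Fintype.card K * Fintype.card K ^ (finrank K V - 1) := by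
        rw [← pow_succ']; congr 1; omega
      rw [e] at hle
      have := Nat.le_of_mul_le_mul_right hle (pow_pos Fintype.card_pos _)
      omega
    have hspan : finrank K (K ∙ v) = 1 := finrank_span_singleton fun h => hvZ (h ▸ Z.zero_mem)
    have hdv : ∀ Y : Submodule K V, v ∉ Y → Disjoint Y (K ∙ v) := fun Y hY =>
      (Submodule.disjoint_span_singleton' (by rintro rfl; exact hY Y.zero_mem)).2 hY
    refine ⟨Z ⊔ K ∙ v, by rw [finrank_sup_of_disjoint (hdv Z hvZ), hZ, hspan], fun i hi => ?_⟩
    rw [sup_comm]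
    exact Disjoint.disjoint_sup_left_of_disjoint_sup_right (hd i hi)
      (hdv _ (hv i hi)).symm

end Subspaces

theorem exists_extension_card_gt (F : Type u) [Field F] [Fintype F] (n : ℕ) :
    ∃ (K : Type u) (_ : Field K) (_ : Fintype K) (_ : Algebra F K), n < Fintype.card K := by
  obtain ⟨p, hp⟩ := CharP.exists F
  have : Fact p.Prime := ⟨CharP.char_is_prime F p⟩
  -- Degree `n + 1` suffices, since `n + 1 < |F| ^ (n + 1)`.
  let E := FiniteField.Extension F p (n + 1)
  have : Finite (ULift.{u} E) := inferInstance
  have : Fintype (ULift.{u} E) := Fintype.ofFinite _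
  refine ⟨ULift.{u} E, inferInstance, this, inferInstance, ?_⟩
  rw [← Nat.card_eq_fintype_card, Nat.card_congr Equiv.ulift, FiniteField.natCard_extension]
  exact n.lt_succ_self.trans (Nat.lt_pow_self Finite.one_lt_card)

/-- The kernel of a matrix has the same dimension over every finite extension field. -/
theorem finrank_ker_map {F K : Type*} [Field F] [Field K] [Algebra F K] [FiniteDimensional F K]
    {m n : Type*} [Fintype n] (A : Matrix m n F) :
    finrank K (LinearMap.ker (A.map (algebraMap F K)).mulVecLin) =
      finrank F (LinearMap.ker A.mulVecLin) := by
  classical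
  let b := Module.finBasis F K
  -- A matrix over `F` acts on each coordinate of `K` over `F` separately, so the kernel over `K` is
  -- `[K : F]` copies of the kernel over `F`.
  have hrepr : ∀ (x : n → K) (i : m) c, b.repr ((A.map (algebraMap F K) *ᵥ x) i) c =
      (A *ᵥ fun j => b.repr (x j) c) i := fun x i c => by
    simp only [mulVec, dotProduct, map_sum, Finsupp.coe_finsetSum, Finset.sum_apply, map_apply]
    refine sum_congr rfl fun j _ => ?_
    rw [← Algebra.smul_def, map_smul, Finsupp.smul_apply, smul_eq_mul]
  have hmem : ∀ x : n → K, x ∈ LinearMap.ker (A.map (algebraMap F K)).mulVecLin ↔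
      ∀ c, (fun j => b.repr (x j) c) ∈ LinearMap.ker A.mulVecLin := fun x => by
    simp only [LinearMap.mem_ker, mulVecLin_apply, funext_iff, Pi.zero_apply, ← hrepr]
    constructor
    · intro h c i
      rw [h i, map_zero, Finsupp.zero_apply]
    · intro h i
      exact b.repr.map_eq_zero_iff.1 (Finsupp.ext fun c => h c i)
  let e : LinearMap.ker (A.map (algebraMap F K)).mulVecLin ≃ₗ[F]
      (Fin (finrank F K) → LinearMap.ker A.mulVecLin) :=
    { toFun := fun x c => ⟨fun j => b.repr (x.1 j) c, (hmem x.1).1 x.2 c⟩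
      invFun := fun y => ⟨fun j => b.equivFun.symm fun c => (y c).1 j, (hmem _).2 fun c => by
        convert (y c).2 using 1
        ext j
        rw [← b.equivFun_apply, LinearEquiv.apply_symm_apply]⟩
      left_inv := fun x => by
        ext j
        exact b.equivFun.symm_apply_apply (x.1 j)
      right_inv := fun y => by
        ext c j
        change b.equivFun (b.equivFun.symm fun c => (y c).1 j) c = _
        rw [LinearEquiv.apply_symm_apply]
      map_add' := fun x y => by ext c j; simp
      map_smul' := fun r x => by ext c j; simp }
  have h1 := e.finrank_eq
  rw [← finrank_mul_finrank F K, finrank_pi_fintype, sum_const, card_univ, Fintype.card_fin,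
    smul_eq_mul] at h1
  exact Nat.eq_of_mul_eq_mul_left finrank_pos h1

/-- Dual form of the kernel of a finite family of linear maps. -/
theorem sup_dualAnnihilator {F V ι : Type*} [Field F] [AddCommGroup V] [Module F V]
    [FiniteDimensional F V] (S : Finset ι) (U : ι → Submodule F V) :
    S.sup (fun i => (U i).dualAnnihilator) = (S.inf U).dualAnnihilator := by
  classical
  induction S using Finset.induction_on with
  | empty => simp
  | insert a S ha ih => rw [sup_insert, inf_insert, ih, Subspace.dualAnnihilator_inf_eq]

/-! ### Linear codes -/

namespace LinearRegeneratingCode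

variable {𝔽 : Type u} [Field 𝔽] {k d α β B : ℕ} (C : LinearRegeneratingCode 𝔽 k d α β B)

/-- The messages that node `i` stores as zero. -/
def storeKer (i : Fin (d + 1)) : Submodule 𝔽 (Fin B → 𝔽) :=
  LinearMap.ker (C.store i).mulVecLin

/-- The messages for which node `i` sends zero to node `j`. -/
def repairKer (i j : Fin (d + 1)) : Submodule 𝔽 (Fin B → 𝔽) :=
  LinearMap.ker (C.repair i j * C.store i).mulVecLin

theorem finrank_dualAnnihilator_ker_le {n B : ℕ} (A : Matrix (Fin n) (Fin B) 𝔽) :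
    finrank 𝔽 (LinearMap.ker A.mulVecLin).dualAnnihilator ≤ n := by
  have h1 := Subspace.finrank_add_finrank_dualAnnihilator_eq (LinearMap.ker A.mulVecLin)
  have h2 := A.mulVecLin.finrank_range_add_finrank_ker
  have h3 := Submodule.finrank_le (LinearMap.range A.mulVecLin)
  rw [finrank_fin_fun] at h3
  omega

theorem isRepairFamily (hMSR : IsMSR k d α β B) :
    IsRepairFamily k (d - k + 1) α β (fun i => (C.storeKer i).dualAnnihilator)
      (fun i j => (C.repairKer i j).dualAnnihilator) where
  card_eq := by have := hMSR.1; rw [Fintype.card_fin]; omega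
  r_pos := Nat.succ_pos _
  a_eq := hMSR.2.2
  finrank_eq := by rw [Subspace.dual_finrank_eq, finrank_fin_fun, hMSR.2.1]
  finrank_store i := finrank_dualAnnihilator_ker_le _
  finrank_repair i j := finrank_dualAnnihilator_ker_le _
  repair_le i j := Submodule.dualAnnihilator_anti fun x hx => by
    simp only [storeKer, repairKer, LinearMap.mem_ker, mulVecLin_apply] at hx ⊢
    rw [← mulVec_mulVec, hx, mulVec_zero]
  span A hA := by
    rw [sup_dualAnnihilator, ← Submodule.dualAnnihilator_bot]
    congr 1
    refine (Submodule.eq_bot_iff _).2 fun x hx => C.reconstruction A hA x 0 fun i hi => ?_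
    rw [mulVec_zero]
    exact (Submodule.mem_finsetInf.1 hx) i hi
  regenerate j := by
    rw [sup_dualAnnihilator]
    refine Submodule.dualAnnihilator_anti fun x hx => ?_
    have := C.regeneration j x 0 fun i hi => by
      rw [mulVec_zero, mulVec_zero, mulVec_mulVec]
      exact (Submodule.mem_finsetInf.1 hx) i (mem_erase.2 ⟨hi, mem_univ _⟩)
    rwa [mulVec_zero] at this

/-- The matrix of the linear map from messages to the observation of an eavesdropper. -/
def obsMatrix (E F : Finset (Fin (d + 1))) :
    Matrix ((E × Fin α) ⊕ ((Σ j : F, {i : Fin (d + 1) // i ≠ j}) × Fin β)) (Fin B) 𝔽 :=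
  Matrix.of (Sum.elim (fun e => C.store e.1 e.2)
    fun z => (C.repair z.1.2 z.1.1 * C.store z.1.2) z.2)

variable (K : Type u) [Field K] [Algebra 𝔽 K]

theorem repairData_eq (i j : Fin (d + 1)) (x : Fin B → K) :
    C.repairData K i j x = (C.repair i j * C.store i).map (algebraMap 𝔽 K) *ᵥ x := by
  rw [repairData, content, mulVec_mulVec, Matrix.map_mul]

theorem observation_eq_iff (E F : Finset (Fin (d + 1))) (x y : Fin B → K) :
    C.observation K E F x = C.observation K E F y ↔
      ((C.obsMatrix E F).map (algebraMap 𝔽 K)).mulVecLin x =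
        ((C.obsMatrix E F).map (algebraMap 𝔽 K)).mulVecLin y := by
  have h1 : ∀ (z : Fin B → K) e a, ((C.obsMatrix E F).map (algebraMap 𝔽 K)).mulVecLin z
      (Sum.inl (e, a)) = C.content K e z a := fun z e a => rfl
  have h2 : ∀ (z : Fin B → K) j i b, ((C.obsMatrix E F).map (algebraMap 𝔽 K)).mulVecLin z
      (Sum.inr (⟨j, i⟩, b)) = C.repairData K i j z b := fun z j i b => by
    rw [repairData_eq]; rfl
  constructor
  · intro h
    obtain ⟨hs, hr⟩ := Prod.mk.inj h
    ext (⟨e, a⟩ | ⟨⟨j, i⟩, b⟩)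
    · rw [h1, h1]; exact congrFun (congrFun hs e) a
    · rw [h2, h2]; exact congrFun (congrFun (congrFun hr j) i) b
  · intro h
    refine Prod.ext (funext fun e => funext fun a => ?_)
      (funext fun j => funext fun i => funext fun b => ?_)
    · have := congrFun h (Sum.inl (e, a)); rwa [h1, h1] at this
    · have := congrFun h (Sum.inr (⟨j, i⟩, b)); rwa [h2, h2] at this

theorem ker_obsMatrix (E F : Finset (Fin (d + 1))) :
    LinearMap.ker (C.obsMatrix E F).mulVecLin =
      E.inf C.storeKer ⊓ F.inf fun j => (univ.erase j).inf fun i => C.repairKer i j := by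
  ext x
  simp only [Submodule.mem_inf, Submodule.mem_finsetInf, LinearMap.mem_ker, storeKer, repairKer,
    mulVecLin_apply]
  constructor
  · intro h
    exact ⟨fun i hi => funext fun a => congrFun h (Sum.inl (⟨i, hi⟩, a)),
      fun j hj i hi => funext fun b =>
        congrFun h (Sum.inr (⟨⟨j, hj⟩, ⟨i, (mem_erase.1 hi).1⟩⟩, b))⟩
  · rintro ⟨hs, hr⟩
    ext (⟨e, a⟩ | ⟨⟨j, i⟩, b⟩)
    · exact congrFun (hs e e.2) a
    · exact congrFun (hr j j.2 i (mem_erase.2 ⟨i.2, mem_univ _⟩)) b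

theorem finrank_ker_obsMatrix (E F : Finset (Fin (d + 1))) :
    finrank 𝔽 (LinearMap.ker (C.obsMatrix E F).mulVecLin) +
      finrank 𝔽 (E.sup (fun i => (C.storeKer i).dualAnnihilator) ⊔
        F.sup (fun j => (univ.erase j).sup fun i => (C.repairKer i j).dualAnnihilator)
        : Submodule 𝔽 (Dual 𝔽 (Fin B → 𝔽))) = B := by
  have hF : F.sup (fun j => (univ.erase j).sup fun i => (C.repairKer i j).dualAnnihilator) =
      (F.inf fun j => (univ.erase j).inf fun i => C.repairKer i j).dualAnnihilator := by
    rw [← sup_dualAnnihilator]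
    exact sup_congr rfl fun j _ => sup_dualAnnihilator _ _
  rw [hF, sup_dualAnnihilator, ← Subspace.dualAnnihilator_inf_eq, ← ker_obsMatrix,
    Subspace.finrank_add_finrank_dualAnnihilator_eq, finrank_fin_fun]

/-- This ties the entropy `π` to the subspace dimensions: the data have the same fibres as the
quotient by the common kernel. -/
theorem repairEntropy_eq [Fintype 𝔽] (g : Fin (d + 1)) (F : Finset (Fin (d + 1))) :
    C.repairEntropy g F =
      finrank 𝔽 (F.sup fun j => (C.repairKer g j).dualAnnihilator
        : Submodule 𝔽 (Dual 𝔽 (Fin B → 𝔽))) := by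
  rw [repairEntropy, entropy_uniform (F.inf (C.repairKer g)).mkQ fun x y => ?_]
  · rw [Submodule.ker_mkQ, sup_dualAnnihilator, sub_eq_iff_eq_add', ← Nat.cast_add,
      Subspace.finrank_add_finrank_dualAnnihilator_eq]
  · rw [Submodule.mkQ_apply, Submodule.mkQ_apply, Submodule.Quotient.eq, Submodule.mem_finsetInf]
    simp only [repairKer, LinearMap.mem_ker, map_sub, sub_eq_zero, mulVecLin_apply,
      repairData_eq, Algebra.algebraMap_self, RingHom.coe_id, Matrix.map_id]
    exact ⟨fun h i hi => congrFun h ⟨i, hi⟩, fun h => funext fun j => h j j.2⟩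

theorem content_injective [FiniteDimensional 𝔽 K] {A : Finset (Fin (d + 1))} (hA : A.card = k)
    {x y : Fin B → K} (h : ∀ i ∈ A, C.content K i x = C.content K i y) : x = y := by
  -- An eavesdropper on `(A, ∅)` sees exactly the contents of `A`; injectivity over `𝔽` then passes
  -- to `K` by `finrank_ker_map`.
  have hker : LinearMap.ker (C.obsMatrix A ∅).mulVecLin = ⊥ := by
    rw [ker_obsMatrix, inf_empty, inf_top_eq]
    refine (Submodule.eq_bot_iff _).2 fun x hx => C.reconstruction A hA x 0 fun i hi => ?_
    rw [mulVec_zero]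
    exact (Submodule.mem_finsetInf.1 hx) i hi
  have hK := finrank_ker_map (K := K) (C.obsMatrix A ∅)
  rw [hker, finrank_bot, Submodule.finrank_eq_zero, LinearMap.ker_eq_bot] at hK
  apply hK
  rw [← observation_eq_iff]
  refine Prod.ext (funext fun e => h e e.2) (funext fun j => ?_)
  exact absurd j.2 (notMem_empty _)

/-! ### Achievability and converse for the secrecy capacity -/

variable [Fintype 𝔽]

/-- The message is uniform and the file is its class modulo a subspace `Z` of dimension `B - m`. If
`Z` and each kernel span everything, the class and the observation are independent. -/
theorem mem_secureFileSizes {𝓔 : Set (Finset (Fin (d + 1)) × Finset (Fin (d + 1)))} {m : ℕ}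
    (hmB : m ≤ B)
    (hm : ∀ EF ∈ 𝓔, m ≤ finrank 𝔽 (LinearMap.ker (C.obsMatrix EF.1 EF.2).mulVecLin)) :
    (m : ℝ) ∈ C.secureFileSizes 𝓔 := by
  classical
  obtain ⟨K, _, _, _, hcard⟩ := exists_extension_card_gt 𝔽
    (Fintype.card (Finset (Fin (d + 1)) × Finset (Fin (d + 1))))
  have : FiniteDimensional 𝔽 K := Module.Finite.of_finite
  let f := fun EF : Finset (Fin (d + 1)) × Finset (Fin (d + 1)) =>
    ((C.obsMatrix EF.1 EF.2).map (algebraMap 𝔽 K)).mulVecLin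
  have hf : ∀ EF, finrank K (LinearMap.ker (f EF)) =
    finrank 𝔽 (LinearMap.ker (C.obsMatrix EF.1 EF.2).mulVecLin) := fun EF => finrank_ker_map _
  have hN : ∀ EF ∈ 𝓔, ∃ N ≤ LinearMap.ker (f EF), finrank K N = m := fun EF hEF => by
    -- With no subspaces to avoid, the lemma just yields an `m`-dimensional part of the kernel, for
    -- which `Z` can be a complement.
    obtain ⟨Z, hZ, -⟩ := exists_disjoint_of_card_lt (K := K) (V := LinearMap.ker (f EF))
      (∅ : Finset Unit) (fun _ => ⊥) (by simpa using Fintype.card_pos) m (by simp)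
      (by rw [hf]; exact hm EF hEF)
    exact ⟨Z.map (LinearMap.ker (f EF)).subtype, Submodule.map_subtype_le _ _, by
      rw [Submodule.finrank_map_subtype_eq, hZ]⟩
  choose! N hNle hNm using hN
  obtain ⟨Z, hZ, hZd⟩ := exists_disjoint_of_card_lt (K := K) (V := Fin B → K)
    (univ.filter (· ∈ 𝓔)) N ((card_le_univ _).trans_lt hcard) (B - m)
    (fun EF hEF => by
      rw [hNm EF (by simpa using hEF), finrank_fin_fun]; omega) (by rw [finrank_fin_fun]; omega)
  have hinf : ∀ EF ∈ 𝓔, finrank K (Z ⊓ LinearMap.ker (f EF) : Submodule K (Fin B → K)) + m =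
      finrank K (LinearMap.ker (f EF)) := fun EF hEF => by
    have h1 := finrank_sup_of_disjoint (hZd EF (by simpa using hEF))
    have h2 := Submodule.finrank_mono (sup_le_sup_left (hNle EF hEF) Z)
    have h3 := Submodule.finrank_le (Z ⊔ LinearMap.ker (f EF))
    have h4 := Submodule.finrank_sup_add_finrank_inf_eq Z (LinearMap.ker (f EF))
    rw [finrank_fin_fun] at h3
    rw [hNm EF hEF] at h1
    omega
  have : Fintype ((Fin B → K) ⧸ Z) := Fintype.ofFinite _
  let e := Fintype.equivFin ((Fin B → K) ⧸ Z)
  have hD : entropy (Fintype.card K) ((PMF.uniformOfFintype (Fin B → K)).map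
      fun x => (e (Z.mkQ x), x)) Prod.fst = m := by
    rw [entropy_map, entropy_uniform (X := Prod.fst ∘ fun x => (e (Z.mkQ x), x)) Z.mkQ
      (fun x y => e.injective.eq_iff), Submodule.ker_mkQ, hZ,
      finrank_fin_fun, Nat.cast_sub hmB, sub_sub_cancel]
  refine ⟨K, inferInstance, inferInstance, inferInstance, _,
    (PMF.uniformOfFintype (Fin B → K)).map fun x => (e (Z.mkQ x), x), ⟨?_, ?_⟩, hD.symm⟩
  · intro A hA a ha b hb hab
    rw [PMF.support_map] at ha hb
    obtain ⟨x, -, rfl⟩ := ha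
    obtain ⟨y, -, rfl⟩ := hb
    have : x = y := C.content_injective K hA hab
    rw [this]
  · intro EF hEF
    rw [mutualInfo, hD, entropy_map, entropy_map,
      entropy_uniform (X := (fun a => C.observation K EF.1 EF.2 a.2) ∘ fun x => (e (Z.mkQ x), x))
        (f EF) (fun x y => C.observation_eq_iff K EF.1 EF.2 x y),
      entropy_uniform (Z.mkQ.prod (f EF)) fun x y => ?_, LinearMap.ker_prod, Submodule.ker_mkQ,
      ← hinf EF hEF]
    · push_cast
      ring
    · exact Prod.mk_inj.trans ((and_congr e.injective.eq_iff
        (C.observation_eq_iff K EF.1 EF.2 x y)).trans Prod.mk_inj.symm)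

omit [Fintype 𝔽] in
theorem le_of_mem_secureFileSizes (hkd : k ≤ d)
    {𝓔 : Set (Finset (Fin (d + 1)) × Finset (Fin (d + 1)))} {EF} (hEF : EF ∈ 𝓔) {r : ℝ}
    (hr : r ∈ C.secureFileSizes 𝓔) :
    r ≤ finrank 𝔽 (LinearMap.ker (C.obsMatrix EF.1 EF.2).mulVecLin) := by
  obtain ⟨K, _, _, _, N, p, ⟨hdet, hI⟩, rfl⟩ := hr
  have : FiniteDimensional 𝔽 K := Module.Finite.of_finite
  obtain ⟨A, -, hA⟩ := exists_subset_card_eq (s := (univ : Finset (Fin (d + 1)))) (n := k)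
    (by rw [card_univ, Fintype.card_fin]; omega)
  rw [← finrank_ker_map (K := K)]
  exact entropy_le_finrank_ker p _ (fun x y => C.observation_eq_iff K EF.1 EF.2 x y)
    (fun u hu v hv huv => hdet A hA u hu v hv fun i _ => by rw [huv]) (hI EF hEF)

theorem isSecrecyCapacity (hkd : k ≤ d)
    {𝓔 : Set (Finset (Fin (d + 1)) × Finset (Fin (d + 1)))} {s : ℝ} {EF} (hEF : EF ∈ 𝓔)
    (hs : (finrank 𝔽 (LinearMap.ker (C.obsMatrix EF.1 EF.2).mulVecLin) : ℝ) = s)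
    (hle : ∀ EF ∈ 𝓔, s ≤ finrank 𝔽 (LinearMap.ker (C.obsMatrix EF.1 EF.2).mulVecLin)) :
    C.IsSecrecyCapacity 𝓔 s := by
  subst hs
  refine ⟨C.mem_secureFileSizes ?_ fun EF' h => by exact_mod_cast hle EF' h,
    fun r hr => C.le_of_mem_secureFileSizes hkd hEF hr⟩
  have := C.finrank_ker_obsMatrix EF.1 EF.2
  omega

/-- The number of message symbols about which the eavesdropper learns nothing. -/
theorem finrank_ker_obsMatrix_eq (hMSR : IsMSR k d α β B) {l₁ l₂ : ℕ} (hl : l₁ + l₂ < k)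
    {EF : Finset (Fin (d + 1)) × Finset (Fin (d + 1))} (hEF : EF ∈ eavesdroppers (d + 1) l₁ l₂)
    {g : Fin (d + 1)} (hg : g ∉ EF.2) :
    (finrank 𝔽 (LinearMap.ker (C.obsMatrix EF.1 EF.2).mulVecLin) : ℝ) =
      ((k : ℝ) - l₁ - l₂) * ((α : ℝ) - C.repairEntropy g EF.2) := by
  obtain ⟨E, F⟩ := EF
  obtain ⟨rfl, rfl, hd⟩ : E.card = l₁ ∧ F.card = l₂ ∧ Disjoint E F := hEF
  have h := C.isRepairFamily hMSR
  have hc : k - E.card - F.card ≤ (E ∪ F)ᶜ.card := by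
    have h1 := card_compl_add_card (E ∪ F)
    have := hMSR.1
    rw [card_union_of_disjoint hd, Fintype.card_fin] at h1
    omega
  obtain ⟨G, hG, hGc⟩ := exists_subset_card_eq hc
  have hGd : Disjoint G (E ∪ F) := disjoint_left.2 fun i hi hi' => (mem_compl.1 (hG hi)) hi'
  have h1 := C.finrank_ker_obsMatrix E F
  rw [h.finrank_observation hd hGd (by omega) (by omega), sum_congr rfl fun g' hg' =>
    h.finrank_sup_repair_eq (by omega)
      (fun hi => disjoint_left.1 hGd hg' (mem_union_right _ hi)) hg, sum_const, smul_eq_mul] at h1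
  rw [repairEntropy_eq]
  have hGk : (G.card : ℝ) = k - E.card - F.card := by
    rw [hGc, Nat.cast_sub (by omega), Nat.cast_sub (by omega)]
  have h2 := congrArg (Nat.cast (R := ℝ)) h1
  have hB : (B : ℝ) = k * α := by exact_mod_cast hMSR.2.1
  push_cast at h2
  rw [hGk] at h2
  linear_combination h2 + hB

theorem piDescription (hMSR : IsMSR k d α β B) {l : ℕ} (hl : l < k)
    {F : Finset (Fin (d + 1))} (hF : F.card = l) {g : Fin (d + 1)} (hg : g ∉ F) :
    PiDescription k d β l (C.repairEntropy g F) := by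
  rw [repairEntropy_eq]
  exact (C.isRepairFamily hMSR).piDescription (by have := hMSR.1; omega) hF hl hg

end LinearRegeneratingCode

end SecureMSR

end

theorem mainTheorem9 {𝔽 : Type*} [Field 𝔽] [Fintype 𝔽] {k d α β B : ℕ}
    (C : SecureMSR.LinearRegeneratingCode 𝔽 k d α β B) (hMSR : SecureMSR.IsMSR k d α β B)
    (l₁ l₂ : ℕ) (hl : l₁ + l₂ < k) :
    (∀ EF ∈ SecureMSR.eavesdroppers (d + 1) l₁ l₂, ∀ g ∉ EF.2,
      C.IsSecrecyCapacity {EF}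
        (((k : ℝ) - l₁ - l₂) * ((α : ℝ) - C.repairEntropy g EF.2)) ∧
      SecureMSR.PiDescription k d β l₂ (C.repairEntropy g EF.2)) ∧
    ∃ π : ℝ,
      IsGreatest {h : ℝ | ∃ (F : Finset (Fin (d + 1))) (g : Fin (d + 1)),
        F.card = l₂ ∧ g ∉ F ∧ h = C.repairEntropy g F} π ∧
      C.IsSecrecyCapacity (SecureMSR.eavesdroppers (d + 1) l₁ l₂)
        (((k : ℝ) - l₁ - l₂) * ((α : ℝ) - π)) ∧
      SecureMSR.PiDescription k d β l₂ π := by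
  have hkd := hMSR.1
  have hex : ∀ F : Finset (Fin (d + 1)), F.card = l₂ → ∃ g, g ∉ F := fun F hF => by
    by_contra! hcon
    have := Finset.card_le_card (fun g _ => hcon g : Finset.univ ⊆ F)
    rw [Finset.card_univ, Fintype.card_fin] at this
    omega
  refine ⟨fun EF hEF g hg => ⟨?_, C.piDescription hMSR (by omega) hEF.2.1 hg⟩, ?_⟩
  · have hker := C.finrank_ker_obsMatrix_eq hMSR hl hEF hg
    refine C.isSecrecyCapacity hkd (Set.mem_singleton EF) hker ?_
    rintro _ rfl
    exact hker.ge
  obtain ⟨F₀, -, hF₀⟩ := Finset.exists_subset_card_eq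
    (s := (Finset.univ : Finset (Fin (d + 1)))) (n := l₂)
    (by rw [Finset.card_univ, Fintype.card_fin]; omega)
  obtain ⟨g₀, hg₀⟩ := hex F₀ hF₀
  obtain ⟨⟨F, g⟩, ⟨hF, hg⟩, hmax⟩ := Set.exists_max_image
    {x : Finset (Fin (d + 1)) × Fin (d + 1) | x.1.card = l₂ ∧ x.2 ∉ x.1}
    (fun x => C.repairEntropy x.2 x.1) (Set.toFinite _) ⟨(F₀, g₀), hF₀, hg₀⟩
  -- The rank depends on `F` alone, so any `E` disjoint from the maximizing `F` gives a worst-case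
  -- eavesdropper: the largest `π` leaves the smallest kernel.
  obtain ⟨E, hEF, hE⟩ := Finset.exists_subset_card_eq (s := Fᶜ) (n := l₁) (by
    have := Finset.card_compl_add_card F
    rw [Fintype.card_fin] at this
    simp only at hF
    omega)
  have hmem : (E, F) ∈ SecureMSR.eavesdroppers (d + 1) l₁ l₂ :=
    ⟨hE, hF, Finset.disjoint_left.2 fun i hi => Finset.mem_compl.1 (hEF hi)⟩
  refine ⟨C.repairEntropy g F, ⟨⟨F, g, hF, hg, rfl⟩, ?_⟩, ?_,
    C.piDescription hMSR (by omega) hF hg⟩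
  · rintro _ ⟨F', g', hF', hg', rfl⟩
    exact hmax (F', g') ⟨hF', hg'⟩
  · refine C.isSecrecyCapacity hkd hmem (C.finrank_ker_obsMatrix_eq hMSR hl hmem hg)
      fun EF' hEF' => ?_
    obtain ⟨g', hg'⟩ := hex EF'.2 hEF'.2.1
    rw [C.finrank_ker_obsMatrix_eq hMSR hl hEF' hg']
    have h1 := hmax (EF'.2, g') ⟨hEF'.2.1, hg'⟩
    have h2 : (l₁ : ℝ) + l₂ ≤ k := by exact_mod_cast hl.le
    exact mul_le_mul_of_nonneg_left (sub_le_sub_left h1 _) (by linarith)
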